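/- Let $(\Omega,\Sigma,\mathbb P)$ be a non-atomic standard probability space (a standard Borel space with a Borel probability measure that vanishes on points), let $1<p<\infty$, and let $L_p=L_p(\Omega,\Sigma,\mathbb P)$ be the real Banach space with norm $\|f\|_p=(\mathbb E|f|^p)^{1/p}$. For $g\in L_p$ put $\mathbf h_g(f)=\|f-g\|_p-\|g\|_p$. The metric compactification $\overline{L_p}^{h}$ is the closure of $\{\mathbf h_g : g\in L_p\}$ in $\mathbb R^{L_p}$ for the topology of pointwise convergence; its elements are called metric functionals. A random measure on $\mathbb R$ is a measurable family $\xi=(\xi_\omega)_{\omega\in\Omega}$ of Borel probability measures on $\mathbb R$. Every metric functional $\mathbf h\in\overline{L_p}^{h}$ has exactly one of the following two forms: either $$\mathbf h(f)=\Big(\mathbb E\Big[\int_{\mathbb R}|f-r|^p\,d\xi(r)\Big]-\mathbb E\Big[\int_{\mathbb R}|r|^p\,d\xi(r)\Big]+c^p\Big)^{1/p}-c\qquad(f\in L_p),\tag{1}$$ where $\xi$ is a random measure on $\mathbb R$ and $c\ge 0$ satisfies $c^p\ge\mathbb E\big[\int_{\mathbb R}|r|^p\,d\xi(r)\big]$ (so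 that all these expectations are finite), or $$\mathbf h(f)=-\mathbb E[f\zeta]\qquad(f\in L_p),\tag{2}$$ where $\zeta$ is an element of the closed unit ball of $L_{p/(p-1)}$. Moreover, let $(g_\alpha)$ be a net in $L_p$ such that $\mathbf h_{g_\alpha}$ converges pointwise on $L_p$ to a function $\mathbf h$. If $(\|g_\alpha\|_p)$ is eventually bounded, then $\mathbf h$ has the form (1); otherwise $\mathbf h$ has the form (2). Finally, for every $\zeta$ in the closed unit ball of $L_{p/(p-1)}$, the functional $f\mapsto-\mathbb E[f\zeta]$ is a metric functional on $L_p$. -/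

import Mathlib

open MeasureTheory ProbabilityTheory Filter Topology
open scoped ENNReal

/-- The internal metric functional `x ↦ d(x, y) - d(x₀, y)` of the point `y`,
with basepoint `x₀`. -/
def internalMetricFunctional {X : Type*} [MetricSpace X] (x₀ y : X) : X → ℝ :=
  fun x => dist x y - dist x₀ y

/-- The metric compactification of `X` with basepoint `x₀`: the closure of the set of internal
metric functionals in `X → ℝ`, whose topology is that of pointwise convergence. Its elements are
the metric functionals on `X`. -/
def metricCompactification {X : Type*} [MetricSpace X] (x₀ : X) : Set (X → ℝ) :=
  closure (Set.range fun y => internalMetricFunctional x₀ y)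

section Forms

variable {Ω : Type*} [MeasurableSpace Ω]

/-- `E[∫ |f - r| ^ p dξ(r)]`, as an extended nonnegative number. -/
noncomputable def randomMoment (P : Measure Ω) (p : ℝ≥0∞) (ξ : Kernel Ω ℝ) (f : Ω → ℝ) : ℝ≥0∞ :=
  ∫⁻ ω, ∫⁻ r, ENNReal.ofReal (|f ω - r| ^ p.toReal) ∂(ξ ω) ∂P

/-- `h` is of the form
`f ↦ (E[∫ |f - r| ^ p dξ(r)] - E[∫ |r| ^ p dξ(r)] + c ^ p) ^ (1 / p) - c`,
for a random (probability) measure `ξ` on `ℝ`, i.e. a Markov kernel from `Ω` to `ℝ`, and a real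
number `c ≥ 0` with `E[∫ |r| ^ p dξ(r)] ≤ c ^ p`. Both expectations are finite. -/
def HasRandomMeasureForm (P : Measure Ω) (p : ℝ≥0∞) (h : Lp ℝ p P → ℝ) : Prop :=
  ∃ (ξ : Kernel Ω ℝ) (c : ℝ), IsMarkovKernel ξ ∧ 0 ≤ c ∧
    randomMoment P p ξ (fun _ => 0) ≤ ENNReal.ofReal (c ^ p.toReal) ∧
    ∀ f : Lp ℝ p P, randomMoment P p ξ f ≠ ∞ ∧
      h f = ((randomMoment P p ξ f).toReal - (randomMoment P p ξ (fun _ => 0)).toReal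
        + c ^ p.toReal) ^ (1 / p.toReal) - c

/-- The functional `f ↦ - E[f ζ]` on `L_p`, for `ζ` in `L_{p / (p - 1)}`. -/
noncomputable def negPairing (P : Measure Ω) (p : ℝ≥0∞) (ζ : Lp ℝ (p / (p - 1)) P) :
    Lp ℝ p P → ℝ :=
  fun f => - ∫ ω, f ω * ζ ω ∂P

/-- `h` is of the form `f ↦ - E[f ζ]` with `ζ` in the closed unit ball of `L_{p / (p - 1)}`. -/
def HasLinearForm (P : Measure Ω) (p : ℝ≥0∞) (h : Lp ℝ p P → ℝ) : Prop :=
  ∃ ζ : Lp ℝ (p / (p - 1)) P, ‖ζ‖ ≤ 1 ∧ h = negPairing P p ζ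

end Forms

/-! Bounded case: view `g i` as the law on `Ω × ℝ` of `(ω, g i ω)`. Bounded `p`-th moments and the
fixed first marginal `P` make these laws tight. An ultrafilter limit exists and disintegrates as `P
⊗ₘ ξ`, while `‖g i‖` tends to some `c`. The moments `|r| ^ p` may lose mass in the limit, whence
only `E[∫ |r| ^ p dξ] ≤ c ^ p`. For bounded continuous `φ`, however, `|φ - r| ^ p - |r| ^ p` grows
more slowly than `|r| ^ p`, so its expectation converges (`exists_kernel_tendsto_integral`). Density
and the Lipschitz property of `h` give the formula on all of `L_p`.

Unbounded case: refine so that `‖g i‖ → ∞`, and let `u i` in the unit ball of `L_q` norm `g i`. Then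
`‖f - g i‖ - ‖g i‖ + E[f (u i)]` is nonnegative, and its sum over `f` and `-f` is a second
difference of the norm, which vanishes at infinity because `L_p` is uniformly smooth. Hence `h f =
-lim E[f (u i)]`. The compactness of random measures, applied to `u i`, identifies the limit: `ζ` is
the barycenter of the limiting random measure.

Conversely, a `ζ` of norm one is reached along multiples of the vector that norms it. A shorter `ζ`
is a weak limit of vectors of norm one, since `L_q` is infinite-dimensional. The forms exclude each
other because the first is bounded below and never identically zero. -/

/-! ### Elementary inequalities for powers, and `L_p` norms as integrals. -/

/-- By homogeneity, continuity of `|t - 1| ^ s` at `0` settles small `|a| / |r|`; otherwise both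
powers are `O(|a| ^ s)`. -/
theorem abs_sub_rpow_sub_le {s : ℝ} (hs : 0 < s) {ε : ℝ} (hε : 0 < ε) :
    ∃ K : ℝ, 0 ≤ K ∧ ∀ a r : ℝ, |(|a - r| ^ s - |r| ^ s)| ≤ ε * |r| ^ s + K * |a| ^ s := by
  have hc : ContinuousAt (fun t : ℝ => |t - 1| ^ s) 0 := by
    apply ContinuousAt.rpow_const (by fun_prop)
    right; exact hs.le
  obtain ⟨δ, hδ, H⟩ := Metric.continuousAt_iff.1 hc ε hε
  refine ⟨(1 + 2 / δ) ^ s + (2 / δ) ^ s, by positivity, fun a r => ?_⟩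
  have ha := abs_nonneg a
  have hr := abs_nonneg r
  by_cases h : |a| < δ * |r|
  · have hr0 : r ≠ 0 := by
      rintro rfl
      simp at h
      linarith
    have hr1 : 0 < |r| := abs_pos.2 hr0
    have h1 := H (x := a / r) (by
      rw [Real.dist_eq, sub_zero, abs_div, div_lt_iff₀ hr1]; exact h)
    rw [Real.dist_eq] at h1
    simp only [zero_sub, abs_neg, abs_one, Real.one_rpow] at h1
    have h2 : |a - r| ^ s = |r| ^ s * |a / r - 1| ^ s := by
      rw [← Real.mul_rpow hr (abs_nonneg _), ← abs_mul]
      congr 2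
      field_simp
    have h3 : |a - r| ^ s - |r| ^ s = |r| ^ s * (|a / r - 1| ^ s - 1) := by rw [h2]; ring
    rw [h3, abs_mul, abs_of_nonneg (by positivity : (0 : ℝ) ≤ |r| ^ s), mul_comm ε]
    have h4 : |r| ^ s * |(|a / r - 1| ^ s - 1)| ≤ |r| ^ s * ε := by gcongr
    have : 0 ≤ ((1 + 2 / δ) ^ s + (2 / δ) ^ s) * |a| ^ s := by positivity
    linarith
  · push Not at h
    have h1 : |r| ≤ 2 / δ * |a| := by
      have : |r| ≤ |a| / δ := by rw [le_div_iff₀ hδ]; linarith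
      have h5 : 0 ≤ |a| / δ := by positivity
      calc |r| ≤ |a| / δ := this
        _ ≤ 2 * (|a| / δ) := by linarith
        _ = _ := by ring
    have h2 : |a - r| ≤ (1 + 2 / δ) * |a| := by
      have := abs_sub a r
      linarith
    have h3 : |a - r| ^ s ≤ (1 + 2 / δ) ^ s * |a| ^ s := by
      rw [← Real.mul_rpow (by positivity) ha]; gcongr
    have h4 : |r| ^ s ≤ (2 / δ) ^ s * |a| ^ s := by
      rw [← Real.mul_rpow (by positivity) ha]; gcongr
    have h5 : 0 ≤ |a - r| ^ s := by positivity
    have h6 : 0 ≤ |r| ^ s := by positivity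
    have h7 : 0 ≤ ε * |r| ^ s := by positivity
    rw [abs_le]
    constructor <;> nlinarith

/-- After scaling by `|a|`, this says that `(1 + t) ^ s + (1 - t) ^ s - 2` has derivative zero at
`0`. It is the pointwise source of the smoothness of `L_p`. -/
theorem second_difference_abs_rpow_le {s : ℝ} (hs : 1 < s) {ε : ℝ} (hε : 0 < ε) :
    ∃ K : ℝ, 0 ≤ K ∧ ∀ a b : ℝ, |b - a| ^ s + |-b - a| ^ s - 2 * |a| ^ s
      ≤ ε * (|a| ^ (s - 1) * |b|) + K * |b| ^ s := by
  have hd : HasDerivAt (fun t : ℝ => (1 + t) ^ s + (1 - t) ^ s - 2) 0 0 := by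
    have h1 : HasDerivAt (fun t : ℝ => 1 + t) 1 0 := (hasDerivAt_id 0).const_add 1
    have h2 : HasDerivAt (fun t : ℝ => 1 - t) (-1) 0 := (hasDerivAt_id 0).const_sub 1
    have h3 : HasDerivAt (fun t : ℝ => (1 + t) ^ s + (1 - t) ^ s - 2) _ 0 :=
      ((h1.rpow_const (p := s) (by left; simp)).add
        (h2.rpow_const (p := s) (by left; simp))).sub_const 2
    simpa using h3
  have ho := hd.isLittleO
  rw [Asymptotics.isLittleO_iff] at ho
  obtain ⟨δ, hδ, H⟩ := Metric.eventually_nhds_iff.1 (ho hε)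
  set δ' := min δ 1 with hδ'
  have hδ'0 : 0 < δ' := lt_min hδ one_pos
  refine ⟨2 * (1 + 1 / δ') ^ s, by positivity, fun a b => ?_⟩
  have ha := abs_nonneg a
  have hb := abs_nonneg b
  by_cases h : |b| < δ' * |a|
  · have ha0 : a ≠ 0 := by
      rintro rfl
      simp at h
      linarith
    have ha1 : 0 < |a| := abs_pos.2 ha0
    have hlt : |b / a| < δ' := by rw [abs_div, div_lt_iff₀ ha1]; exact h
    have hlt1 : |b / a| < 1 := hlt.trans_le (min_le_right _ _)
    have h1 := H (y := b / a) (by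
      rw [Real.dist_eq, sub_zero]; exact hlt.trans_le (min_le_left _ _))
    simp only [add_zero, sub_zero, Real.one_rpow, smul_zero, Real.norm_eq_abs] at h1
    have h1' := (le_abs_self _).trans h1
    rw [abs_lt] at hlt1
    have e1 : |b - a| ^ s = |a| ^ s * (1 - b / a) ^ s := by
      rw [← abs_of_pos (by linarith : 0 < 1 - b / a), ← Real.mul_rpow ha (abs_nonneg _), ← abs_mul,
        abs_sub_comm]
      congr 2
      field_simp
    have e2 : |-b - a| ^ s = |a| ^ s * (1 + b / a) ^ s := by
      rw [← abs_of_pos (by linarith : 0 < 1 + b / a), ← Real.mul_rpow ha (abs_nonneg _), ← abs_mul,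
        abs_sub_comm]
      congr 2
      field_simp
      ring
    have e3 : |a| ^ s * |b / a| = |a| ^ (s - 1) * |b| := by
      rw [abs_div, Real.rpow_sub_one ha1.ne']
      field_simp
    have h4 : |a| ^ s * ((1 + b / a) ^ s + (1 - b / a) ^ s - 2) ≤ |a| ^ s * (ε * |b / a|) := by
      gcongr
      linarith
    have : 0 ≤ 2 * (1 + 1 / δ') ^ s * |b| ^ s := by positivity
    rw [e1, e2, ← e3]
    linarith
  · push Not at h
    have h1 : |a| ≤ 1 / δ' * |b| := by
      rw [one_div_mul_eq_div, le_div_iff₀ hδ'0]; linarith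
    have key : ∀ c, |c| ≤ |a| + |b| → |c| ^ s ≤ (1 + 1 / δ') ^ s * |b| ^ s := fun c hc => by
      rw [← Real.mul_rpow (by positivity) hb]
      gcongr
      linarith
    have h2 := key (b - a) (by have := abs_sub b a; linarith)
    have h3 := key (-b - a) (by have := abs_sub (-b) a; rw [abs_neg] at this; linarith)
    have h6 : 0 ≤ |a| ^ s := by positivity
    have h7 : 0 ≤ ε * (|a| ^ (s - 1) * |b|) := by positivity
    linarith

/-- The tangent line at `a` lies below the convex power; this is Bernoulli's inequality, rescaled.
-/
theorem add_mul_rpow_sub_one_le_rpow {s a x : ℝ} (hs : 1 ≤ s) (ha : 0 < a) (hx : 0 ≤ x) :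
    a ^ s + s * a ^ (s - 1) * (x - a) ≤ x ^ s := by
  have h := one_add_mul_self_le_rpow_one_add (s := x / a - 1) (p := s)
    (by have : 0 ≤ x / a := by positivity
        linarith) hs
  have h1 : a ^ s * (1 + s * (x / a - 1)) ≤ a ^ s * (1 + (x / a - 1)) ^ s := by gcongr
  rw [add_sub_cancel, ← Real.mul_rpow ha.le (by positivity), mul_div_cancel₀ _ ha.ne'] at h1
  refine le_trans (le_of_eq ?_) h1
  rw [Real.rpow_sub_one ha.ne']
  field_simp

theorem rpow_sub_one_mul_le {s x y : ℝ} (hs : 1 ≤ s) (hx : 0 ≤ x) (hy : 0 ≤ y) :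
    x ^ (s - 1) * y ≤ x ^ s + y ^ s := by
  have h0 : 0 ≤ x ^ s := by positivity
  have h1 : 0 ≤ y ^ s := by positivity
  rcases le_total x y with h | h
  · have : x ^ (s - 1) * y ≤ y ^ (s - 1) * y := by gcongr
    rw [← Real.rpow_add_one' hy (by linarith), sub_add_cancel] at this
    linarith
  · have : x ^ (s - 1) * y ≤ x ^ (s - 1) * x := by gcongr
    rw [← Real.rpow_add_one' hx (by linarith), sub_add_cancel] at this
    linarith

theorem MeasureTheory.MemLp.integrable_abs_rpow {Ω : Type*} [MeasurableSpace Ω]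
    {P : Measure Ω} {p : ℝ≥0∞} {f : Ω → ℝ} (hf : MemLp f p P) (hp : p ≠ 0)
    (hp' : p ≠ ∞) : Integrable (fun ω => |f ω| ^ p.toReal) P := by
  simpa only [Real.norm_eq_abs] using hf.integrable_norm_rpow hp hp'

section LpNorm

variable {Ω : Type*} [MeasurableSpace Ω] {P : Measure Ω} {p : ℝ≥0∞} [Fact (1 ≤ p)]

theorem MeasureTheory.Lp.ofReal_norm_rpow (hp : p ≠ 0) (hp' : p ≠ ∞) (f : Lp ℝ p P) :
    ENNReal.ofReal (‖f‖ ^ p.toReal) = ∫⁻ ω, ENNReal.ofReal (|f ω| ^ p.toReal) ∂P := by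
  have hp0 := ENNReal.toReal_pos hp hp'
  rw [← ENNReal.ofReal_rpow_of_nonneg (norm_nonneg _) hp0.le, ofReal_norm, Lp.enorm_def,
    eLpNorm_eq_lintegral_rpow_enorm_toReal hp hp', ← ENNReal.rpow_mul, one_div,
    inv_mul_cancel₀ hp0.ne', ENNReal.rpow_one]
  refine lintegral_congr fun ω => ?_
  rw [← ENNReal.ofReal_rpow_of_nonneg (abs_nonneg _) hp0.le, ← Real.norm_eq_abs,
    ofReal_norm]

theorem MeasureTheory.Lp.norm_rpow_eq_integral (hp : p ≠ 0) (hp' : p ≠ ∞) (f : Lp ℝ p P) :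
    ‖f‖ ^ p.toReal = ∫ ω, |f ω| ^ p.toReal ∂P := by
  rw [integral_eq_lintegral_of_nonneg_ae (ae_of_all _ fun ω => by positivity)
    ((Lp.memLp f).integrable_abs_rpow hp hp').1, ← Lp.ofReal_norm_rpow hp hp',
    ENNReal.toReal_ofReal (by positivity)]

end LpNorm

/-! ### Weak convergence tested against unbounded continuous functions. -/

section WeakConvergence

variable {X ι : Type*} [TopologicalSpace X] [MeasurableSpace X] [OpensMeasurableSpace X]

open scoped NNReal BoundedContinuousFunction in
/-- Lower semicontinuity of the integral of a nonnegative continuous function. -/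
theorem lintegral_le_of_tendsto_probabilityMeasure {l : Filter ι} [l.NeBot]
    {μ : ι → ProbabilityMeasure X} {ν : ProbabilityMeasure X} (hμ : Tendsto μ l (𝓝 ν))
    {φ : X → ℝ} (hφ : Continuous φ) {C : ℝ≥0∞}
    (hC : ∀ᶠ i in l, ∫⁻ x, ENNReal.ofReal (φ x) ∂(μ i : Measure X) ≤ C) :
    ∫⁻ x, ENNReal.ofReal (φ x) ∂(ν : Measure X) ≤ C := by
  -- Bounded truncations of `φ` at height `n`; monotone convergence then recovers `φ`.
  let ψ (n : ℕ) : X →ᵇ ℝ≥0 := BoundedContinuousFunction.mkOfBound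
    ⟨fun x => min (φ x).toNNReal n, by fun_prop⟩ n (fun x y => by
      simp only [ContinuousMap.coe_mk, NNReal.dist_eq]
      have h1 : ((min (φ x).toNNReal n : ℝ≥0) : ℝ) ≤ n := by exact_mod_cast min_le_right _ _
      have h2 : ((min (φ y).toNNReal n : ℝ≥0) : ℝ) ≤ n := by exact_mod_cast min_le_right _ _
      have h3 := NNReal.coe_nonneg (min (φ x).toNNReal n)
      have h4 := NNReal.coe_nonneg (min (φ y).toNNReal n)
      rw [abs_le]
      constructor <;> linarith)
  have hψ : ∀ n x, ψ n x = min (φ x).toNNReal n := fun _ _ => rfl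
  have hsup : ∀ x, ENNReal.ofReal (φ x) = ⨆ n, (ψ n x : ℝ≥0∞) := fun x => by
    apply le_antisymm
    · obtain ⟨n, hn⟩ := exists_nat_ge (φ x).toNNReal
      refine le_iSup_of_le n ?_
      rw [hψ, min_eq_left hn]
      rfl
    · refine iSup_le fun n => ?_
      rw [hψ]
      exact ENNReal.coe_le_coe.2 (min_le_left _ _)
  have hle : ∀ n x, (ψ n x : ℝ≥0∞) ≤ ENNReal.ofReal (φ x) := fun n x => by
    rw [hsup]; exact le_iSup (fun n => (ψ n x : ℝ≥0∞)) n
  simp_rw [hsup]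
  rw [lintegral_iSup]
  · refine iSup_le fun n => ?_
    refine le_of_tendsto (ProbabilityMeasure.tendsto_iff_forall_lintegral_tendsto.1 hμ (ψ n)) ?_
    filter_upwards [hC] with i hi
    exact (lintegral_mono (hle n)).trans hi
  · exact fun n => (ENNReal.continuous_coe.comp (ψ n).continuous).measurable
  · intro m n hmn x
    simp only [hψ]
    gcongr

theorem abs_sub_clamp_le {x y K : ℝ} (hy : 0 ≤ y) (hK : 0 ≤ K) (h : |x| ≤ y + K) :
    |x - max (-K) (min x K)| ≤ y := by
  rw [abs_le] at h ⊢
  rcases le_total x K with h1 | h1 <;> rcases le_total (-K) x with h2 | h2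
  · simp [h1, h2, hy]
  · simp [h1, h2]; constructor <;> linarith
  · have : -K ≤ K := by linarith
    simp [h1, this]; constructor <;> linarith
  · have : -K ≤ K := by linarith
    simp [h1, this]; constructor <;> linarith

theorem integrable_of_lintegral_ofReal_le {μ : Measure X} {φ : X → ℝ} (hφ : Continuous φ)
    (hφ0 : ∀ x, 0 ≤ φ x) {C : ℝ} (hC0 : 0 ≤ C)
    (h : ∫⁻ x, ENNReal.ofReal (φ x) ∂μ ≤ ENNReal.ofReal C) :
    Integrable φ μ ∧ ∫ x, φ x ∂μ ≤ C := by
  refine ⟨⟨hφ.measurable.aestronglyMeasurable, ?_⟩, ?_⟩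
  · rw [hasFiniteIntegral_iff_ofReal (ae_of_all _ hφ0)]
    exact h.trans_lt ENNReal.ofReal_lt_top
  · rw [integral_eq_lintegral_of_nonneg_ae (ae_of_all _ hφ0) hφ.measurable.aestronglyMeasurable]
    exact ENNReal.toReal_le_of_le_ofReal hC0 h

theorem integrable_of_abs_le_mul_add {μ : Measure X} [IsFiniteMeasure μ] {φ F : X → ℝ}
    (hφ : Integrable φ μ) (hF : Continuous F) {ε K : ℝ} (h : ∀ x, |F x| ≤ ε * φ x + K) :
    Integrable F μ :=
  ((hφ.const_mul ε).add (integrable_const K)).mono' hF.measurable.aestronglyMeasurable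
    (ae_of_all _ h)

open scoped BoundedContinuousFunction in
/-- Weak convergence extends to continuous functions that grow more slowly than a function with
bounded integrals. -/
theorem tendsto_integral_of_tendsto_probabilityMeasure {l : Filter ι} [l.NeBot]
    {μ : ι → ProbabilityMeasure X} {ν : ProbabilityMeasure X} (hμ : Tendsto μ l (𝓝 ν))
    {φ : X → ℝ} (hφ : Continuous φ) (hφ0 : ∀ x, 0 ≤ φ x) {C : ℝ} (hC0 : 0 ≤ C)
    (hC : ∀ᶠ i in l, ∫⁻ x, ENNReal.ofReal (φ x) ∂(μ i : Measure X) ≤ ENNReal.ofReal C)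
    {F : X → ℝ} (hF : Continuous F) (h : ∀ ε > 0, ∃ K, ∀ x, |F x| ≤ ε * φ x + K) :
    Integrable F (ν : Measure X) ∧
      Tendsto (fun i => ∫ x, F x ∂(μ i : Measure X)) l (𝓝 (∫ x, F x ∂(ν : Measure X))) := by
  obtain ⟨hνi, hνC⟩ := integrable_of_lintegral_ofReal_le hφ hφ0 hC0
    (lintegral_le_of_tendsto_probabilityMeasure hμ hφ hC)
  refine ⟨?_, ?_⟩
  · obtain ⟨K, hK⟩ := h 1 one_pos
    exact integrable_of_abs_le_mul_add hνi hF hK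
  rw [Metric.tendsto_nhds]
  intro ε hε
  obtain ⟨K₀, hK₀⟩ := h (ε / (3 * (C + 1))) (by positivity)
  set ε' := ε / (3 * (C + 1)) with hε'
  have hε'0 : 0 < ε' := by positivity
  have hε'C : ε' * C < ε / 3 := by
    rw [hε', div_mul_eq_mul_div, div_lt_div_iff₀ (by positivity) (by positivity)]
    nlinarith
  set K := max K₀ 0 with hKdef
  have hK0 : 0 ≤ K := le_max_right _ _
  have hK : ∀ x, |F x| ≤ ε' * φ x + K := fun x =>
    (hK₀ x).trans (by have := le_max_left K₀ 0; linarith)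
  -- Clamping `F` to `[-K, K]` costs at most `ε' * φ`, whose integral stays below `ε / 3` uniformly.
  let G : X →ᵇ ℝ := BoundedContinuousFunction.ofNormedAddCommGroup
    (fun x => max (-K) (min (F x) K)) (by fun_prop) K (fun x => by
      rw [Real.norm_eq_abs, abs_le]
      exact ⟨le_max_left _ _, max_le (by linarith) (min_le_right _ _)⟩)
  have hG : ∀ x, |F x - G x| ≤ ε' * φ x := fun x =>
    abs_sub_clamp_le (by have := hφ0 x; positivity) hK0 (hK x)
  have key : ∀ m : ProbabilityMeasure X, Integrable φ (m : Measure X) →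
      ∫ x, φ x ∂(m : Measure X) ≤ C →
      |(∫ x, F x ∂(m : Measure X)) - ∫ x, G x ∂(m : Measure X)| < ε / 3 := by
    intro m hm hmC
    rw [← integral_sub (integrable_of_abs_le_mul_add hm hF hK) (G.integrable _)]
    refine (abs_integral_le_integral_abs).trans_lt ?_
    have h1 : ∫ x, |F x - G x| ∂(m : Measure X) ≤ ∫ x, ε' * φ x ∂(m : Measure X) :=
      integral_mono_of_nonneg (ae_of_all _ fun x => abs_nonneg _) (hm.const_mul _)
        (ae_of_all _ hG)
    rw [integral_const_mul] at h1
    have h2 : ε' * ∫ x, φ x ∂(m : Measure X) ≤ ε' * C := by gcongr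
    linarith
  have hGt := ProbabilityMeasure.tendsto_iff_forall_integral_tendsto.1 hμ G
  filter_upwards [hC, Metric.tendsto_nhds.1 hGt (ε / 3) (by positivity)] with i hi hGi
  obtain ⟨hi1, hi2⟩ := integrable_of_lintegral_ofReal_le hφ hφ0 hC0 hi
  have h1 := key (μ i) hi1 hi2
  have h2 := key ν hνi hνC
  rw [Real.dist_eq] at hGi ⊢
  rw [abs_lt] at *
  constructor <;> linarith

end WeakConvergence

/-! ### Compactness of random measures. -/

section Young

variable {Ω ι : Type*} [TopologicalSpace Ω] [PolishSpace Ω] [MeasurableSpace Ω] [BorelSpace Ω]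
  {P : Measure Ω} [IsProbabilityMeasure P]

/-- The probability measures on `Ω × ℝ` with first marginal `P` whose second marginals have
uniformly bounded moments of order `s` are tight. -/
theorem isTightMeasureSet_of_moment_le {s C : ℝ} (hs : 0 < s) :
    IsTightMeasureSet {μ : Measure (Ω × ℝ) | μ.fst = P ∧
      ∫⁻ z, ENNReal.ofReal (|z.2| ^ s) ∂μ ≤ ENNReal.ofReal C} := by
  apply IsTightMeasureSet.prodMk
  · refine (isTightMeasureSet_singleton (μ := P)).subset ?_
    rintro _ ⟨μ, hμ, rfl⟩
    exact hμ.1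
  · rw [isTightMeasureSet_iff_exists_isCompact_measure_compl_le]
    intro ε hε
    -- Markov's inequality bounds the mass outside `[-R, R]` by `C / R ^ s`.
    have hlim : Tendsto (fun R : ℝ => ENNReal.ofReal C / ENNReal.ofReal (R ^ s)) atTop (𝓝 0) := by
      rw [← ENNReal.div_top (a := ENNReal.ofReal C)]
      exact ENNReal.Tendsto.const_div
        (ENNReal.tendsto_ofReal_atTop.comp (tendsto_rpow_atTop hs)) (by simp)
    obtain ⟨R, hR, hR0⟩ := ((hlim.eventually (gt_mem_nhds hε)).and (eventually_gt_atTop 0)).exists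
    refine ⟨Metric.closedBall 0 R, isCompact_closedBall _ _, ?_⟩
    rintro _ ⟨μ, hμ, rfl⟩
    refine le_trans ?_ hR.le
    rw [Measure.snd_apply Metric.isClosed_closedBall.measurableSet.compl]
    refine le_trans ?_ (ENNReal.div_le_div_right hμ.2 _)
    refine le_trans (measure_mono ?_) (meas_ge_le_lintegral_div ?_ ?_ ?_)
    · intro z hz
      simp only [Set.mem_preimage, Set.mem_compl_iff, Metric.mem_closedBall, Real.dist_eq, sub_zero,
        not_le] at hz
      simp only [Set.mem_ofPred_eq]
      gcongr
    · fun_prop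
    · simpa using Real.rpow_pos_of_pos hR0 s
    · simp

theorem exists_tendsto_of_moment_le (U : Ultrafilter ι) {s C : ℝ} (hs : 0 < s)
    (μ : ι → ProbabilityMeasure (Ω × ℝ)) (hμ : ∀ i, (μ i : Measure (Ω × ℝ)).fst = P)
    (hC : ∀ᶠ i in U, ∫⁻ z, ENNReal.ofReal (|z.2| ^ s) ∂(μ i : Measure (Ω × ℝ))
      ≤ ENNReal.ofReal C) :
    ∃ ν : ProbabilityMeasure (Ω × ℝ), Tendsto μ U (𝓝 ν) ∧ (ν : Measure (Ω × ℝ)).fst = P := by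
  set S : Set (ProbabilityMeasure (Ω × ℝ)) := {m | (m : Measure (Ω × ℝ)).fst = P ∧
      ∫⁻ z, ENNReal.ofReal (|z.2| ^ s) ∂(m : Measure (Ω × ℝ)) ≤ ENNReal.ofReal C} with hS
  have hcomp : IsCompact (closure S) := by
    apply isCompact_closure_of_isTightMeasureSet
    refine (isTightMeasureSet_of_moment_le (P := P) (C := C) hs).subset ?_
    rintro _ ⟨m, hm, rfl⟩
    exact hm
  obtain ⟨ν, -, hν⟩ := hcomp.ultrafilter_le_nhds (U.map μ) (by
    rw [le_principal_iff, Ultrafilter.mem_coe, Ultrafilter.mem_map]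
    filter_upwards [hC] with i hi
    exact subset_closure ⟨hμ i, hi⟩)
  refine ⟨ν, hν, ?_⟩
  let P' : ProbabilityMeasure Ω := ⟨P, inferInstance⟩
  have h1 := (ProbabilityMeasure.continuous_map (Ω := Ω × ℝ) continuous_fst).tendsto ν |>.comp hν
  have h2 : Tendsto (fun i => (μ i).map (f := Prod.fst) continuous_fst.measurable.aemeasurable) U
      (𝓝 P') := by
    have : ∀ i, (μ i).map (f := Prod.fst) continuous_fst.measurable.aemeasurable = P' := fun i =>
      Subtype.ext (hμ i)
    simp_rw [this]
    exact tendsto_const_nhds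
  exact congrArg (fun m : ProbabilityMeasure Ω => (m : Measure Ω)) (tendsto_nhds_unique h1 h2)

/-- Compactness of random measures: a family of functions with bounded moments of order `s`
converges along every ultrafilter to a random measure, when tested against continuous functions
that grow more slowly than `|r| ^ s`. -/
theorem exists_kernel_tendsto_integral (U : Ultrafilter ι) {s C : ℝ} (hs : 0 < s) (hC0 : 0 ≤ C)
    (u : ι → Ω → ℝ) (hu : ∀ i, AEMeasurable (u i) P)
    (hC : ∀ᶠ i in U, ∫⁻ ω, ENNReal.ofReal (|u i ω| ^ s) ∂P ≤ ENNReal.ofReal C) :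
    ∃ ξ : Kernel Ω ℝ, IsMarkovKernel ξ ∧
      (∀ B : ℝ≥0∞, (∀ᶠ i in U, ∫⁻ ω, ENNReal.ofReal (|u i ω| ^ s) ∂P ≤ B) →
        ∫⁻ ω, ∫⁻ r, ENNReal.ofReal (|r| ^ s) ∂(ξ ω) ∂P ≤ B) ∧
      ∀ F : Ω × ℝ → ℝ, Continuous F → (∀ ε > 0, ∃ K, ∀ z, |F z| ≤ ε * |z.2| ^ s + K) →
        Integrable F (P ⊗ₘ ξ) ∧
        Tendsto (fun i => ∫ ω, F (ω, u i ω) ∂P) U (𝓝 (∫ z, F z ∂(P ⊗ₘ ξ))) := by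
  have hm : ∀ i, AEMeasurable (fun ω => (ω, u i ω)) P := fun i => aemeasurable_id.prodMk (hu i)
  let μ (i : ι) : ProbabilityMeasure (Ω × ℝ) :=
    ⟨P.map (fun ω => (ω, u i ω)), Measure.isProbabilityMeasure_map (hm i)⟩
  have hμ : ∀ i, (μ i : Measure (Ω × ℝ)) = P.map (fun ω => (ω, u i ω)) := fun i => rfl
  have hfst : ∀ i, (μ i : Measure (Ω × ℝ)).fst = P := fun i => by
    rw [hμ, Measure.fst, AEMeasurable.map_map_of_aemeasurable measurable_fst.aemeasurable (hm i)]
    exact Measure.map_id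
  have hcont : Continuous fun z : Ω × ℝ => |z.2| ^ s :=
    (continuous_snd.abs).rpow_const fun _ => Or.inr hs.le
  have hmom : ∀ i, ∫⁻ z, ENNReal.ofReal (|z.2| ^ s) ∂(μ i : Measure (Ω × ℝ))
      = ∫⁻ ω, ENNReal.ofReal (|u i ω| ^ s) ∂P := fun i => by
    rw [hμ, lintegral_map' hcont.measurable.ennreal_ofReal.aemeasurable (hm i)]
  obtain ⟨ν, hν, hνP⟩ := exists_tendsto_of_moment_le U hs μ hfst (by simpa only [hmom] using hC)
  have hdis : P ⊗ₘ (ν : Measure (Ω × ℝ)).condKernel = ν := by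
    conv_lhs => rw [← hνP]
    exact Measure.disintegrate _ _
  refine ⟨(ν : Measure (Ω × ℝ)).condKernel, inferInstance, fun B hB => ?_, fun F hF hFK => ?_⟩
  · rw [← Measure.lintegral_compProd (f := fun z : Ω × ℝ => ENNReal.ofReal (|z.2| ^ s))
      hcont.measurable.ennreal_ofReal, hdis]
    exact lintegral_le_of_tendsto_probabilityMeasure hν hcont (by simpa only [hmom] using hB)
  · rw [hdis]
    have := tendsto_integral_of_tendsto_probabilityMeasure hν hcont (fun z => by positivity) hC0
      (by simpa only [hmom] using hC) hF hFK
    refine ⟨this.1, this.2.congr fun i => ?_⟩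
    rw [hμ, integral_map (hm i) hF.measurable.aestronglyMeasurable]

end Young

/-! ### Metric functionals along bounded nets. -/

section Lipschitz

variable {E ι : Type*} [NormedAddCommGroup E] {l : Filter ι} {g : ι → E} {h : E → ℝ}

theorem internalMetricFunctional_zero_apply (y x : E) :
    internalMetricFunctional 0 y x = ‖x - y‖ - ‖y‖ := by
  simp [internalMetricFunctional, dist_eq_norm]

/-- Pointwise limits of 1-Lipschitz functions are 1-Lipschitz. Formulas for `h` thus need checking
only on a dense set. -/
theorem continuous_of_tendsto_internalMetricFunctional [l.NeBot]
    (hl : ∀ f, Tendsto (fun i => internalMetricFunctional 0 (g i) f) l (𝓝 (h f))) :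
    Continuous h := by
  refine (LipschitzWith.of_dist_le_mul (K := 1) fun x y => ?_).continuous
  rw [NNReal.coe_one, one_mul]
  refine le_of_tendsto ((hl x).dist (hl y)) (Eventually.of_forall fun i => ?_)
  rw [internalMetricFunctional_zero_apply, internalMetricFunctional_zero_apply, Real.dist_eq,
    sub_sub_sub_cancel_right, dist_eq_norm]
  refine (abs_norm_sub_norm_le _ _).trans (le_of_eq ?_)
  congr 1
  abel

end Lipschitz

section Bounded

variable {Ω ι : Type*} [MeasurableSpace Ω] {P : Measure Ω} [IsProbabilityMeasure P]
  {p : ℝ≥0∞} [Fact (1 ≤ p)]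

open scoped BoundedContinuousFunction in
theorem hasRandomMeasureForm_of_ultrafilter [TopologicalSpace Ω] [PolishSpace Ω] [BorelSpace Ω]
    (hp' : p ≠ ∞) (U : Ultrafilter ι) {g : ι → Lp ℝ p P}
    {h : Lp ℝ p P → ℝ} (hl : ∀ f, Tendsto (fun i => internalMetricFunctional 0 (g i) f) U (𝓝 (h f)))
    {b : ℝ} (hb : ∀ᶠ i in U, ‖g i‖ ≤ b) : HasRandomMeasureForm P p h := by
  have hp0 : p ≠ 0 := (zero_lt_one.trans_le (Fact.out : 1 ≤ p)).ne'
  have hs : 0 < p.toReal := ENNReal.toReal_pos hp0 hp'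
  obtain ⟨c, ⟨hc0, -⟩, hc⟩ := (isCompact_Icc (a := (0 : ℝ)) (b := b)).ultrafilter_le_nhds
    (U.map fun i => ‖g i‖) (by
      rw [le_principal_iff, Ultrafilter.mem_coe, Ultrafilter.mem_map]
      filter_upwards [hb] with i hi
      exact ⟨norm_nonneg _, hi⟩)
  have hc : Tendsto (fun i => ‖g i‖) U (𝓝 c) := hc
  obtain ⟨ξ, hξ, hmom, hlim⟩ := exists_kernel_tendsto_integral (P := P) U hs
    (C := |b| ^ p.toReal) (by positivity) (fun i => g i)
    (fun i => (Lp.stronglyMeasurable _).measurable.aemeasurable) (by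
      filter_upwards [hb] with i hi
      rw [← Lp.ofReal_norm_rpow hp0 hp']
      gcongr
      exact hi.trans (le_abs_self b))
  have hmom0 : randomMoment P p ξ (fun _ => 0) ≤ ENNReal.ofReal (c ^ p.toReal) := by
    -- Since `‖g i‖ ^ p` merely tends to `c ^ p`, the moment bound is available only for each `B > c
    -- ^ p`.
    refine le_of_forall_gt_imp_ge_of_dense fun B hB => ?_
    simp only [randomMoment, zero_sub, abs_neg]
    refine hmom B ?_
    have h1 : Tendsto (fun i => ENNReal.ofReal (‖g i‖ ^ p.toReal)) U
        (𝓝 (ENNReal.ofReal (c ^ p.toReal))) :=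
      ENNReal.tendsto_ofReal (hc.rpow_const (Or.inr hs.le))
    filter_upwards [h1.eventually (gt_mem_nhds hB)] with i hi
    rw [← Lp.ofReal_norm_rpow hp0 hp']
    exact hi.le
  have hfst : MeasurePreserving Prod.fst (P ⊗ₘ ξ) P :=
    ⟨measurable_fst, Measure.fst_compProd P ξ⟩
  have hsnd : MemLp (Prod.snd : Ω × ℝ → ℝ) p (P ⊗ₘ ξ) := by
    refine ⟨measurable_snd.aestronglyMeasurable, ?_⟩
    rw [eLpNorm_lt_top_iff_lintegral_rpow_enorm_lt_top hp0 hp']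
    refine lt_of_eq_of_lt ?_ (hmom0.trans_lt ENNReal.ofReal_lt_top)
    rw [Measure.lintegral_compProd (f := fun z : Ω × ℝ => ‖z.2‖ₑ ^ p.toReal) (by fun_prop),
      randomMoment]
    refine lintegral_congr fun ω => lintegral_congr fun r => ?_
    rw [zero_sub, abs_neg, ← ENNReal.ofReal_rpow_of_nonneg (abs_nonneg _) hs.le, ← Real.norm_eq_abs,
      ofReal_norm]
  -- On `Ω × ℝ` the random moment of `f` becomes `‖J f - R‖ ^ p`, with `J` the isometric pullback
  -- and `R` the second coordinate. Continuity in `f` is then evident.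
  set J : Lp ℝ p P → Lp ℝ p (P ⊗ₘ ξ) :=
    fun f => Lp.compMeasurePreserving Prod.fst hfst f with hJ
  set R : Lp ℝ p (P ⊗ₘ ξ) := hsnd.toLp _ with hR
  have hJR : ∀ (f : Lp ℝ p P) (φ : Ω → ℝ), f =ᵐ[P] φ →
      (J f - R : Lp ℝ p (P ⊗ₘ ξ)) =ᵐ[P ⊗ₘ ξ] fun z => φ z.1 - z.2 := by
    intro f φ hφ
    filter_upwards [Lp.coeFn_sub (J f) R, Lp.coeFn_compMeasurePreserving f hfst, hsnd.coeFn_toLp,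
      hfst.quasiMeasurePreserving.ae_eq_comp hφ] with z h1 h2 h3 h4
    rw [h1, Pi.sub_apply, h2, h3, h4, Function.comp_apply]
  have hRsnd : ∀ᵐ z ∂(P ⊗ₘ ξ), R z = z.2 := hsnd.coeFn_toLp
  have hmomJ : ∀ f : Lp ℝ p P, randomMoment P p ξ f = ENNReal.ofReal (‖J f - R‖ ^ p.toReal) := by
    intro f
    rw [Lp.ofReal_norm_rpow hp0 hp', randomMoment, ← Measure.lintegral_compProd
      (f := fun z : Ω × ℝ => ENNReal.ofReal (|f z.1 - z.2| ^ p.toReal))]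
    · refine lintegral_congr_ae ?_
      filter_upwards [hJR f f (ae_eq_refl _)] with z hz
      rw [hz]
    · have := (Lp.stronglyMeasurable f).measurable
      fun_prop
  have hmomR : randomMoment P p ξ (fun _ => 0) = ENNReal.ofReal (‖R‖ ^ p.toReal) := by
    rw [Lp.ofReal_norm_rpow hp0 hp', randomMoment, ← Measure.lintegral_compProd
      (f := fun z : Ω × ℝ => ENNReal.ofReal (|0 - z.2| ^ p.toReal)) (by fun_prop)]
    refine lintegral_congr_ae ?_
    filter_upwards [hRsnd] with z hz
    rw [hz, zero_sub, abs_neg]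
  have hform : h = fun f => (‖J f - R‖ ^ p.toReal - ‖R‖ ^ p.toReal + c ^ p.toReal) ^ (1 / p.toReal)
      - c := by
    refine DenseRange.equalizer (BoundedContinuousFunction.toLp_denseRange ℝ P ℝ hp')
      (continuous_of_tendsto_internalMetricFunctional hl) ?_ ?_
    · have hJc : Continuous J := (Lp.isometry_compMeasurePreserving hfst).continuous
      refine Continuous.sub (Continuous.rpow_const ?_ fun f => Or.inr (by positivity))
        continuous_const
      exact (((hJc.sub continuous_const).norm.rpow_const fun f => Or.inr hs.le).sub
        continuous_const).add continuous_const
    · funext φ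
      simp only [Function.comp_apply]
      set f : Lp ℝ p P := BoundedContinuousFunction.toLp p P ℝ φ with hf
      have hfφ : f =ᵐ[P] φ := BoundedContinuousFunction.coeFn_toLp p P ℝ φ
      have hFc : Continuous fun z : Ω × ℝ => |φ z.1 - z.2| ^ p.toReal - |z.2| ^ p.toReal := by
        refine Continuous.sub (Continuous.rpow_const ?_ fun z => Or.inr hs.le)
          (Continuous.rpow_const ?_ fun z => Or.inr hs.le) <;> fun_prop
      obtain ⟨-, ht⟩ := hlim _ hFc (fun ε hε => by
        obtain ⟨K, hK0, hK⟩ := abs_sub_rpow_sub_le hs hε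
        refine ⟨K * ‖φ‖ ^ p.toReal, fun z => (hK _ _).trans ?_⟩
        gcongr
        exact φ.norm_coe_le_norm z.1)
      have hint : ∀ i, ∫ ω, (|φ ω - g i ω| ^ p.toReal - |g i ω| ^ p.toReal) ∂P
          = ‖f - g i‖ ^ p.toReal - ‖g i‖ ^ p.toReal := by
        intro i
        rw [Lp.norm_rpow_eq_integral hp0 hp', Lp.norm_rpow_eq_integral hp0 hp', ← integral_sub
          ((Lp.memLp _).integrable_abs_rpow hp0 hp') ((Lp.memLp _).integrable_abs_rpow hp0 hp')]
        refine integral_congr_ae ?_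
        filter_upwards [Lp.coeFn_sub f (g i), hfφ] with ω h1 h2
        rw [h1, Pi.sub_apply, h2]
      have hint' : ∫ z, (|φ z.1 - z.2| ^ p.toReal - |z.2| ^ p.toReal) ∂(P ⊗ₘ ξ)
          = ‖J f - R‖ ^ p.toReal - ‖R‖ ^ p.toReal := by
        rw [Lp.norm_rpow_eq_integral hp0 hp', Lp.norm_rpow_eq_integral hp0 hp', ← integral_sub
          ((Lp.memLp _).integrable_abs_rpow hp0 hp') ((Lp.memLp _).integrable_abs_rpow hp0 hp')]
        refine integral_congr_ae ?_
        filter_upwards [hJR f φ hfφ, hRsnd] with z h1 h2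
        rw [h1, h2]
      simp only [hint, hint'] at ht
      have ht2 := (((ht.add (hc.rpow_const (p := p.toReal) (Or.inr hs.le))).rpow_const
        (p := 1 / p.toReal) (Or.inr (by positivity))).sub hc)
      refine tendsto_nhds_unique (hl f) (ht2.congr fun i => ?_)
      rw [internalMetricFunctional_zero_apply, sub_add_cancel, one_div,
        Real.rpow_rpow_inv (norm_nonneg _) hs.ne']
  refine ⟨ξ, c, hξ, hc0, hmom0, fun f => ⟨by rw [hmomJ]; exact ENNReal.ofReal_ne_top, ?_⟩⟩
  rw [hmomJ, hmomR, ENNReal.toReal_ofReal (by positivity), ENNReal.toReal_ofReal (by positivity),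
    hform]

theorem hasRandomMeasureForm_of_isBoundedUnder [StandardBorelSpace Ω] (hp' : p ≠ ∞) {l : Filter ι}
    [l.NeBot] {g : ι → Lp ℝ p P} {h : Lp ℝ p P → ℝ}
    (hl : ∀ f, Tendsto (fun i => internalMetricFunctional 0 (g i) f) l (𝓝 (h f)))
    (hb : l.IsBoundedUnder (· ≤ ·) fun i => ‖g i‖) : HasRandomMeasureForm P p h := by
  -- The Polish topology is auxiliary: any compatible one supplies the continuous test functions.
  let _ := upgradeStandardBorel Ω
  obtain ⟨b, hb⟩ := hb
  rw [eventually_map] at hb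
  exact hasRandomMeasureForm_of_ultrafilter hp' (Ultrafilter.of l)
    (fun f => (hl f).mono_left (Ultrafilter.of_le l)) (Ultrafilter.of_le l hb)

end Bounded

/-! ### Duality between `L_p` and `L_q`, and norming vectors. -/

section Pairing

variable {Ω : Type*} [MeasurableSpace Ω]

/-- The duality pairing `(f, u) ↦ E[f u]` between `L_p` and `L_q`. -/
noncomputable def lpMulPairing (P : Measure Ω) (p q : ℝ≥0∞) [Fact (1 ≤ p)] [Fact (1 ≤ q)]
    [p.HolderConjugate q] : Lp ℝ p P →L[ℝ] Lp ℝ q P →L[ℝ] ℝ :=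
  (ContinuousLinearMap.mul ℝ ℝ).lpPairing P p q

variable {P : Measure Ω} {p q : ℝ≥0∞} [Fact (1 ≤ p)] [Fact (1 ≤ q)] [p.HolderConjugate q]

theorem lpMulPairing_apply (f : Lp ℝ p P) (u : Lp ℝ q P) :
    lpMulPairing P p q f u = ∫ ω, f ω * u ω ∂P := by
  rw [lpMulPairing, ContinuousLinearMap.lpPairing_eq_integral]
  rfl

theorem lpMulPairing_apply_of_ae_eq (f : Lp ℝ p P) (u : Lp ℝ q P) {f' u' : Ω → ℝ}
    (hf : f =ᵐ[P] f') (hu : u =ᵐ[P] u') : lpMulPairing P p q f u = ∫ ω, f' ω * u' ω ∂P := by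
  rw [lpMulPairing_apply]
  refine integral_congr_ae ?_
  filter_upwards [hf, hu] with ω h1 h2
  rw [h1, h2]

theorem abs_lpMulPairing_le (f : Lp ℝ p P) (u : Lp ℝ q P) :
    |lpMulPairing P p q f u| ≤ ‖f‖ * ‖u‖ := by
  have h1 := (ContinuousLinearMap.mul ℝ ℝ).norm_holder_apply_apply_le (r := 1) f u
  have h2 := L1.norm_integral_le ((ContinuousLinearMap.mul ℝ ℝ).holder 1 f u)
  rw [L1.integral_eq_integral, integral_congr_ae ((ContinuousLinearMap.mul ℝ ℝ).coeFn_holder f u)]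
    at h2
  rw [lpMulPairing_apply, ← Real.norm_eq_abs]
  refine h2.trans (h1.trans ?_)
  have := ContinuousLinearMap.opNorm_mul_le ℝ ℝ
  calc _ ≤ 1 * ‖f‖ * ‖u‖ := by gcongr
    _ = _ := by rw [one_mul]

/-- Every element of `L_p` is normed by an element of the unit ball of `L_q`. -/
theorem exists_lpMulPairing_eq_norm (hp' : p ≠ ∞) (hq' : q ≠ ∞) (f : Lp ℝ p P) :
    ∃ u : Lp ℝ q P, ‖u‖ ≤ 1 ∧ lpMulPairing P p q f u = ‖f‖ := by
  have hp0 : p ≠ 0 := (zero_lt_one.trans_le (Fact.out : 1 ≤ p)).ne'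
  have hq0 : q ≠ 0 := (zero_lt_one.trans_le (Fact.out : 1 ≤ q)).ne'
  have hpq := ENNReal.HolderConjugate.toReal_of_ne_top (p := p) (q := q) hp' hq'
  set s := p.toReal with hs
  set t := q.toReal with ht
  have hs1 : 1 < s := hpq.lt
  have ht0 : 0 < t := hpq.symm.pos
  by_cases hf : f = 0
  · exact ⟨0, by simp, by simp [hf]⟩
  have hF : 0 < ‖f‖ := norm_pos_iff.2 hf
  have habs : ∀ x : ℝ, |x * |x| ^ (s - 2) / ‖f‖ ^ (s - 1)| ^ t = |x| ^ s / ‖f‖ ^ s := by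
    intro x
    rcases eq_or_ne x 0 with rfl | hx
    · simp [Real.zero_rpow ht0.ne', Real.zero_rpow (by linarith : s ≠ 0)]
    have hx : 0 < |x| := abs_pos.2 hx
    have e1 : |x * |x| ^ (s - 2) / ‖f‖ ^ (s - 1)| = |x| ^ (s - 1) / ‖f‖ ^ (s - 1) := by
      rw [abs_div, abs_mul, abs_of_pos (Real.rpow_pos_of_pos hx _),
        abs_of_pos (Real.rpow_pos_of_pos hF _), show s - 1 = 1 + (s - 2) by ring,
        Real.rpow_add hx, Real.rpow_one]
    rw [e1, ← Real.div_rpow hx.le hF.le, ← Real.rpow_mul (by positivity), hpq.sub_one_mul_conj,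
      Real.div_rpow hx.le hF.le]
  have hmul : ∀ x : ℝ, x * (x * |x| ^ (s - 2) / ‖f‖ ^ (s - 1)) = |x| ^ s / ‖f‖ ^ (s - 1) := by
    intro x
    rcases eq_or_ne x 0 with rfl | hx
    · simp [Real.zero_rpow (by linarith : s ≠ 0)]
    have hx : 0 < |x| := abs_pos.2 hx
    have e : |x| ^ s = |x| * |x| * |x| ^ (s - 2) := by
      rw [Real.rpow_sub hx, Real.rpow_two]
      field_simp
    rw [← mul_div_assoc, ← mul_assoc, ← abs_mul_abs_self x, e]
  have hint := (Lp.memLp f).integrable_abs_rpow hp0 hp'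
  -- The equality case of Hölder's inequality: the signed power of `f` of order `s - 1`, normalised
  -- in `L_q`.
  set v : Ω → ℝ := fun ω => f ω * |f ω| ^ (s - 2) / ‖f‖ ^ (s - 1) with hv
  have hvm : Measurable v := by
    have := (Lp.stronglyMeasurable f).measurable
    fun_prop
  have hvL : MemLp v q P := by
    rw [← integrable_norm_rpow_iff hvm.aestronglyMeasurable hq0 hq']
    simp only [Real.norm_eq_abs, hv, ← ht, habs]
    exact hint.div_const _
  refine ⟨hvL.toLp v, ?_, ?_⟩
  · have h1 : ‖hvL.toLp v‖ ^ t = 1 := by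
      rw [Lp.norm_rpow_eq_integral hq0 hq']
      have : ∫ ω, |hvL.toLp v ω| ^ q.toReal ∂P = ∫ ω, |f ω| ^ s / ‖f‖ ^ s ∂P := by
        refine integral_congr_ae ?_
        filter_upwards [hvL.coeFn_toLp] with ω hω
        rw [hω, ← ht, hv, habs]
      rw [this, integral_div, ← Lp.norm_rpow_eq_integral hp0 hp', div_self (by positivity)]
    have h2 := Real.rpow_rpow_inv (norm_nonneg (hvL.toLp v)) ht0.ne'
    rw [h1, Real.one_rpow] at h2
    exact h2.symm.le
  · rw [lpMulPairing_apply_of_ae_eq f _ (ae_eq_refl _) hvL.coeFn_toLp]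
    simp only [hv, hmul]
    rw [integral_div, ← Lp.norm_rpow_eq_integral hp0 hp', ← hs, Real.rpow_sub_one hF.ne']
    field_simp

end Pairing

/-! ### Smoothness of the norm at infinity. -/

section Smooth

variable {Ω ι : Type*} [MeasurableSpace Ω] {P : Measure Ω} {p : ℝ≥0∞} [Fact (1 ≤ p)]

theorem MeasureTheory.Lp.norm_sub_rpow_eq_integral (hp : p ≠ 0) (hp' : p ≠ ∞) (f g : Lp ℝ p P) :
    ‖f - g‖ ^ p.toReal = ∫ ω, |f ω - g ω| ^ p.toReal ∂P := by
  rw [Lp.norm_rpow_eq_integral hp hp']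
  refine integral_congr_ae ?_
  filter_upwards [Lp.coeFn_sub f g] with ω h
  rw [h, Pi.sub_apply]

/-- Uniform smoothness of `L_p`, at infinity. -/
theorem norm_sub_add_norm_neg_sub_le (hp : 1 < p) (hp' : p ≠ ∞) (f : Lp ℝ p P) {η : ℝ}
    (hη : 0 < η) : ∃ R : ℝ, ∀ g : Lp ℝ p P, R ≤ ‖g‖ → ‖f - g‖ + ‖-f - g‖ - 2 * ‖g‖ ≤ η := by
  have hp0 : p ≠ 0 := (zero_lt_one.trans hp).ne'
  set s := p.toReal with hs
  have hs1 : 1 < s := by rw [hs, ← ENNReal.toReal_one]; gcongr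
  set A := ‖f‖ ^ s with hA
  have hA0 : 0 ≤ A := by positivity
  -- This `ε` makes `ε * (1 + A) = η / 2`, and `R` below makes `K * A` at most `η / 2 * G ^ (s -
  -- 1)`.
  obtain ⟨K, hK0, hK⟩ := second_difference_abs_rpow_le hs1 (ε := η / (2 * (1 + A))) (by positivity)
  set ε := η / (2 * (1 + A)) with hε
  have hε0 : 0 < ε := by positivity
  obtain ⟨R, hR⟩ := eventually_atTop.1 (((tendsto_rpow_atTop (y := s - 1) (by linarith)).eventually
    (eventually_ge_atTop (2 * (K * A) / η))).and (eventually_gt_atTop 0))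
  refine ⟨R, fun g hg => ?_⟩
  obtain ⟨hG1, hG0⟩ := hR _ hg
  set G := ‖g‖ with hG
  have hGs : 0 < G ^ (s - 1) := by positivity
  have hi : ∀ k : Lp ℝ p P, Integrable (fun ω => |k ω| ^ s) P := fun k =>
    (Lp.memLp k).integrable_abs_rpow hp0 hp'
  have hi' : ∀ k k' : Lp ℝ p P, Integrable (fun ω => |k ω - k' ω| ^ s) P := fun k k' =>
    ((Lp.memLp k).sub (Lp.memLp k')).integrable_abs_rpow hp0 hp'
  have hpt : ∀ᵐ ω ∂P, |f ω - g ω| ^ s + |(-f : Lp ℝ p P) ω - g ω| ^ s - 2 * |g ω| ^ s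
      ≤ ε * G ^ (s - 1) * (|g ω| ^ s / G ^ s + |f ω| ^ s) + K * |f ω| ^ s := by
    filter_upwards [Lp.coeFn_neg f] with ω hω
    rw [hω, Pi.neg_apply]
    refine (hK (g ω) (f ω)).trans ?_
    -- Normalising by `G` makes the first term integrate to `1`, so the bound scales as `G ^ (s -
    -- 1)`.
    have h1 := rpow_sub_one_mul_le hs1.le (x := |g ω| / G) (y := |f ω|) (by positivity)
      (by positivity)
    rw [Real.div_rpow (by positivity) hG0.le, Real.div_rpow (by positivity) hG0.le] at h1
    have h2 : |g ω| ^ (s - 1) * |f ω|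
        ≤ G ^ (s - 1) * (|g ω| ^ s / G ^ s + |f ω| ^ s) := by
      calc |g ω| ^ (s - 1) * |f ω|
          = G ^ (s - 1) * (|g ω| ^ (s - 1) / G ^ (s - 1) * |f ω|) := by field_simp
        _ ≤ _ := by gcongr
    rw [mul_assoc ε]
    gcongr
  have hS : Integrable (fun ω => |f ω - g ω| ^ s + |(-f : Lp ℝ p P) ω - g ω| ^ s) P :=
    (hi' f g).add (hi' (-f) g)
  have hT : Integrable (fun ω => |g ω| ^ s / G ^ s + |f ω| ^ s) P :=
    ((hi g).div_const _).add (hi f)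
  have hint := integral_mono_ae (hS.sub ((hi g).const_mul 2))
    ((hT.const_mul (ε * G ^ (s - 1))).add ((hi f).const_mul K)) hpt
  simp only [Pi.add_apply, Pi.sub_apply] at hint
  rw [integral_sub hS ((hi g).const_mul 2), integral_add (hi' f g) (hi' (-f) g),
    integral_const_mul, integral_add (hT.const_mul (ε * G ^ (s - 1))) ((hi f).const_mul K),
    integral_const_mul, integral_const_mul, integral_add ((hi g).div_const (G ^ s)) (hi f),
    integral_div,
    ← Lp.norm_sub_rpow_eq_integral hp0 hp', ← Lp.norm_sub_rpow_eq_integral hp0 hp',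
    ← Lp.norm_rpow_eq_integral hp0 hp', ← Lp.norm_rpow_eq_integral hp0 hp', ← hs, ← hA, ← hG,
    div_self (by positivity)] at hint
  -- Convexity turns the second difference of `s`-th powers of norms into one of norms, with factor
  -- `s * G ^ (s - 1)`.
  have b1 := add_mul_rpow_sub_one_le_rpow hs1.le hG0 (norm_nonneg (f - g))
  have b2 := add_mul_rpow_sub_one_le_rpow hs1.le hG0 (norm_nonneg (-f - g))
  by_contra! hlt
  have h3 : ε * (1 + A) = η / 2 := by rw [hε]; field_simp
  have h4 : K * A ≤ η / 2 * G ^ (s - 1) := by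
    rw [div_le_iff₀ hη] at hG1
    linarith
  have h5 : G ^ (s - 1) * (‖f - g‖ + ‖-f - g‖ - 2 * G) ≤ G ^ (s - 1) * η := by
    have h6 : s * G ^ (s - 1) * (‖f - g‖ + ‖-f - g‖ - 2 * G) ≤ G ^ (s - 1) * η := by
      have : ε * G ^ (s - 1) * (1 + A) = η / 2 * G ^ (s - 1) := by
        rw [mul_right_comm, h3]
      linarith
    refine le_trans ?_ h6
    rw [mul_assoc]
    refine le_mul_of_one_le_left ?_ hs1.le
    have : 0 < ‖f - g‖ + ‖-f - g‖ - 2 * G := hη.trans hlt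
    positivity
  exact absurd (le_of_mul_le_mul_left h5 hGs) (not_le.2 hlt)

variable {q : ℝ≥0∞} [Fact (1 ≤ q)] [p.HolderConjugate q]

/-- If `‖g‖ → ∞` and `u` norms `g`, then the internal metric functional of `g` is asymptotic to
`f ↦ -E[f u]`. -/
theorem tendsto_internalMetricFunctional_add_lpMulPairing (hp : 1 < p) (hp' : p ≠ ∞)
    {l : Filter ι} {g : ι → Lp ℝ p P} (hg : Tendsto (fun i => ‖g i‖) l atTop) {u : ι → Lp ℝ q P}
    (hu : ∀ i, ‖u i‖ ≤ 1) (hgu : ∀ i, lpMulPairing P p q (g i) (u i) = ‖g i‖) (f : Lp ℝ p P) :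
    Tendsto (fun i => internalMetricFunctional 0 (g i) f + lpMulPairing P p q f (u i)) l
      (𝓝 0) := by
  -- As `u i` norms `g i`, this is Hölder's inequality for `k - g i`. At `f` and `-f` it gives two
  -- nonnegative terms with small sum.
  have hlow : ∀ i, ∀ k : Lp ℝ p P,
      0 ≤ internalMetricFunctional 0 (g i) k + lpMulPairing P p q k (u i) := by
    intro i k
    have h1 := (abs_le.1 (abs_lpMulPairing_le (k - g i) (u i))).1
    rw [map_sub, sub_apply, hgu] at h1
    have h2 : ‖k - g i‖ * ‖u i‖ ≤ ‖k - g i‖ :=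
      mul_le_of_le_one_right (norm_nonneg _) (hu i)
    rw [internalMetricFunctional_zero_apply]
    linarith
  rw [Metric.tendsto_nhds]
  intro η hη
  obtain ⟨R, hR⟩ := norm_sub_add_norm_neg_sub_le hp hp' f (half_pos hη)
  filter_upwards [hg.eventually (eventually_ge_atTop R)] with i hi
  have h1 := hlow i f
  have h2 := hlow i (-f)
  have h3 := hR _ hi
  rw [Real.dist_eq, sub_zero, abs_of_nonneg h1]
  rw [map_neg, neg_apply] at h2
  rw [internalMetricFunctional_zero_apply] at h2 ⊢
  linarith

end Smooth

theorem exists_mul_le_mul_rpow_add {t A ε : ℝ} (ht : 1 < t) (hA : 0 ≤ A) (hε : 0 < ε) :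
    ∃ K : ℝ, ∀ x : ℝ, 0 ≤ x → A * x ≤ ε * x ^ t + K := by
  obtain ⟨R, hR⟩ := eventually_atTop.1 ((tendsto_rpow_atTop (y := t - 1) (by linarith)).eventually
    (eventually_ge_atTop (A / ε)))
  refine ⟨A * |R|, fun x hx => ?_⟩
  rcases le_total R x with h | h
  · have h1 : A ≤ ε * x ^ (t - 1) := by
      have := hR x h
      rw [div_le_iff₀ hε] at this
      linarith
    have h2 : A * x ≤ ε * x ^ (t - 1) * x := by gcongr
    rw [mul_assoc, ← Real.rpow_add_one' hx (by linarith), sub_add_cancel] at h2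
    have : 0 ≤ A * |R| := by positivity
    linarith
  · have h1 : A * x ≤ A * |R| := by
      gcongr
      exact h.trans (le_abs_self R)
    have : 0 ≤ ε * x ^ t := by positivity
    linarith

/-! ### Barycenters and unbounded nets. -/

section Barycenter

variable {Ω : Type*} [MeasurableSpace Ω] {P : Measure Ω}

/-- The barycenter of a random measure with `q`-th moment at most `1` lies in the unit ball of
`L_q`. -/
theorem eLpNorm_integral_kernel_le_one {q : ℝ≥0∞} (hq : 1 ≤ q) (hq' : q ≠ ∞) {ξ : Kernel Ω ℝ}
    [IsMarkovKernel ξ]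
    (hξ : ∫⁻ ω, ∫⁻ r, ENNReal.ofReal (|r| ^ q.toReal) ∂(ξ ω) ∂P ≤ 1) :
    eLpNorm (fun ω => ∫ r, r ∂(ξ ω)) q P ≤ 1 := by
  have hq0 : q ≠ 0 := (zero_lt_one.trans_le hq).ne'
  have ht : 0 < q.toReal := ENNReal.toReal_pos hq0 hq'
  rw [eLpNorm_eq_lintegral_rpow_enorm_toReal hq0 hq']
  refine ENNReal.rpow_le_one (le_trans (lintegral_mono fun ω => ?_) hξ) (by positivity)
  have h1 : ‖∫ r, r ∂(ξ ω)‖ₑ ≤ eLpNorm (fun r : ℝ => r) q (ξ ω) := by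
    refine (enorm_integral_le_lintegral_enorm _).trans ?_
    rw [← eLpNorm_one_eq_lintegral_enorm]
    -- Jensen's inequality, as monotonicity of `L_q` norms over the probability measure `ξ ω`.
    exact eLpNorm_le_eLpNorm_of_exponent_le hq measurable_id.aestronglyMeasurable
  rw [eLpNorm_eq_lintegral_rpow_enorm_toReal hq0 hq', one_div] at h1
  have h2 := ENNReal.rpow_le_rpow h1 ht.le
  rw [ENNReal.rpow_inv_rpow ht.ne'] at h2
  refine h2.trans (le_of_eq (lintegral_congr fun r => ?_))
  rw [← ENNReal.ofReal_rpow_of_nonneg (abs_nonneg _) ht.le, ← Real.norm_eq_abs, ofReal_norm]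

end Barycenter

section Unbounded

variable {Ω ι : Type*} [MeasurableSpace Ω] {P : Measure Ω} [IsProbabilityMeasure P]
  {p q : ℝ≥0∞} [Fact (1 ≤ p)] [Fact (1 ≤ q)] [p.HolderConjugate q]

theorem exists_eq_neg_lpMulPairing_of_ultrafilter [TopologicalSpace Ω] [PolishSpace Ω]
    [BorelSpace Ω] (hp : 1 < p) (hp' : p ≠ ∞) (hq' : q ≠ ∞) (U : Ultrafilter ι)
    {g : ι → Lp ℝ p P} (hg : Tendsto (fun i => ‖g i‖) U atTop) {h : Lp ℝ p P → ℝ}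
    (hl : ∀ f, Tendsto (fun i => internalMetricFunctional 0 (g i) f) U (𝓝 (h f))) :
    ∃ ζ : Lp ℝ q P, ‖ζ‖ ≤ 1 ∧ h = fun f => -lpMulPairing P p q f ζ := by
  have hq1 : 1 ≤ q := Fact.out
  have hq0 : q ≠ 0 := (zero_lt_one.trans_le hq1).ne'
  have hpq := ENNReal.HolderConjugate.toReal_of_ne_top (p := p) (q := q) hp' hq'
  have ht1 : 1 < q.toReal := hpq.symm.lt
  choose u hu hgu using fun i => exists_lpMulPairing_eq_norm (q := q) hp' hq' (g i)
  have hmom : ∀ i, ∫⁻ ω, ENNReal.ofReal (|u i ω| ^ q.toReal) ∂P ≤ 1 := fun i => by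
    rw [← Lp.ofReal_norm_rpow hq0 hq']
    exact ENNReal.ofReal_le_one.2 (Real.rpow_le_one (norm_nonneg _) (hu i) (by linarith))
  obtain ⟨ξ, hξ, hξm, hlim⟩ := exists_kernel_tendsto_integral (P := P) U
    (zero_lt_one.trans ht1) zero_le_one (fun i => u i)
    (fun i => (Lp.stronglyMeasurable _).measurable.aemeasurable)
    (Eventually.of_forall fun i => by simpa using hmom i)
  have hζ1 := eLpNorm_integral_kernel_le_one hq1 hq' (hξm 1 (Eventually.of_forall hmom))
  have hζm : MemLp (fun ω => ∫ r, r ∂(ξ ω)) q P :=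
    ⟨(StronglyMeasurable.integral_kernel (κ := ξ) stronglyMeasurable_id).aestronglyMeasurable,
      hζ1.trans_lt ENNReal.one_lt_top⟩
  refine ⟨hζm.toLp _, ?_, ?_⟩
  · rw [Lp.norm_toLp]
    exact ENNReal.toReal_le_of_le_ofReal zero_le_one (by simpa using hζ1)
  refine DenseRange.equalizer (BoundedContinuousFunction.toLp_denseRange ℝ P ℝ hp')
    (continuous_of_tendsto_internalMetricFunctional hl)
    ((lpMulPairing P p q).flip (hζm.toLp _)).continuous.neg ?_
  funext φ
  simp only [Function.comp_apply]
  set f : Lp ℝ p P := BoundedContinuousFunction.toLp p P ℝ φ with hf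
  have hfφ : f =ᵐ[P] φ := BoundedContinuousFunction.coeFn_toLp p P ℝ φ
  -- Linear growth in `r` is admissible because `q > 1`.
  obtain ⟨hi, ht⟩ := hlim (fun z => φ z.1 * z.2) (by fun_prop) (fun ε hε => by
    obtain ⟨K, hK⟩ := exists_mul_le_mul_rpow_add ht1 (norm_nonneg φ) hε
    refine ⟨K, fun z => le_trans ?_ (hK _ (abs_nonneg z.2))⟩
    rw [abs_mul]
    gcongr
    exact φ.norm_coe_le_norm z.1)
  have hφξ : ∀ ω, ∫ r, φ ω * r ∂(ξ ω) = φ ω * ∫ r, r ∂(ξ ω) := fun ω => integral_const_mul _ _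
  rw [Measure.integral_compProd hi] at ht
  simp only [hφξ] at ht
  rw [← lpMulPairing_apply_of_ae_eq f _ hfφ hζm.coeFn_toLp] at ht
  have h1 := tendsto_internalMetricFunctional_add_lpMulPairing hp hp' hg hu hgu f
  have h2 : Tendsto (fun i => lpMulPairing P p q f (u i)) U
      (𝓝 (lpMulPairing P p q f (hζm.toLp _))) := ht.congr fun i =>
    (lpMulPairing_apply_of_ae_eq f _ hfφ (ae_eq_refl _)).symm
  have h3 := h1.sub h2
  simp only [add_sub_cancel_right, zero_sub] at h3
  exact tendsto_nhds_unique (hl f) h3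

/-- Unboundedness gives large values only frequently; this refinement of `l` forces `φ` to infinity.
-/
theorem neBot_inf_comap_atTop {α : Type*} {l : Filter α} {φ : α → ℝ}
    (h : ¬ l.IsBoundedUnder (· ≤ ·) φ) : (l ⊓ comap φ atTop).NeBot := by
  rw [Filter.inf_neBot_iff]
  intro s hs t ht
  obtain ⟨t', ht', htt'⟩ := mem_comap.1 ht
  obtain ⟨b, hb⟩ := mem_atTop_sets.1 ht'
  by_contra hne
  refine h ⟨b, ?_⟩
  rw [eventually_map]
  filter_upwards [hs] with i hi
  by_contra! hlt
  exact hne ⟨i, hi, htt' (hb _ hlt.le)⟩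

theorem exists_eq_neg_lpMulPairing_of_not_isBoundedUnder [StandardBorelSpace Ω] (hp : 1 < p)
    (hp' : p ≠ ∞) (hq' : q ≠ ∞) {l : Filter ι} {g : ι → Lp ℝ p P} {h : Lp ℝ p P → ℝ}
    (hl : ∀ f, Tendsto (fun i => internalMetricFunctional 0 (g i) f) l (𝓝 (h f)))
    (hb : ¬ l.IsBoundedUnder (· ≤ ·) fun i => ‖g i‖) :
    ∃ ζ : Lp ℝ q P, ‖ζ‖ ≤ 1 ∧ h = fun f => -lpMulPairing P p q f ζ := by
  let _ := upgradeStandardBorel Ω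
  have := neBot_inf_comap_atTop hb
  have hle := Ultrafilter.of_le (l ⊓ comap (fun i => ‖g i‖) atTop)
  exact exists_eq_neg_lpMulPairing_of_ultrafilter hp hp' hq' (Ultrafilter.of _)
    (tendsto_comap.mono_left (hle.trans inf_le_right))
    (fun f => (hl f).mono_left (hle.trans inf_le_left))

end Unbounded

/-! ### Realising every element of the dual ball. -/

section Converse

variable {Ω : Type*} [MeasurableSpace Ω] {P : Measure Ω}
  {p q : ℝ≥0∞} [Fact (1 ≤ p)] [Fact (1 ≤ q)] [p.HolderConjugate q]

theorem neg_lpMulPairing_mem_metricCompactification_of_norm_eq_one (hp : 1 < p) (hp' : p ≠ ∞)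
    (hq' : q ≠ ∞) {ζ : Lp ℝ q P} (hζ : ‖ζ‖ = 1) :
    (fun f => -lpMulPairing P p q f ζ) ∈ metricCompactification (0 : Lp ℝ p P) := by
  have : q.HolderConjugate p := ENNReal.HolderConjugate.symm
  obtain ⟨v, hv, hζv⟩ := exists_lpMulPairing_eq_norm (q := p) hq' hp' ζ
  have hvζ : lpMulPairing P p q v ζ = 1 := by
    rw [← hζ, ← hζv, lpMulPairing_apply, lpMulPairing_apply]
    simp_rw [mul_comm]
  have hv1 : ‖v‖ = 1 := by
    have h1 := (le_abs_self _).trans (abs_lpMulPairing_le v ζ)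
    rw [hvζ, hζ, mul_one] at h1
    exact le_antisymm hv h1
  have hnorm : ∀ n : ℕ, ‖(n : ℝ) • v‖ = n := fun n => by
    rw [norm_smul, hv1, mul_one, Real.norm_natCast]
  have hlim : Tendsto (fun n : ℕ => ‖(n : ℝ) • v‖) atTop atTop := by
    simp only [hnorm]
    exact tendsto_natCast_atTop_atTop
  refine mem_closure_of_tendsto (f := fun n : ℕ => internalMetricFunctional 0 ((n : ℝ) • v))
    (b := atTop) (tendsto_pi_nhds.2 fun f => ?_) (Eventually.of_forall fun n => ⟨_, rfl⟩)
  have h1 := tendsto_internalMetricFunctional_add_lpMulPairing hp hp' hlim (u := fun _ => ζ)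
    (fun _ => hζ.le) (fun n => by
      rw [hnorm, map_smul, smul_apply, hvζ, smul_eq_mul, mul_one]) f
  simpa using h1.sub_const (lpMulPairing P p q f ζ)

/-- A bounded injective function on an atomless probability space satisfies no polynomial
equation. -/
theorem Polynomial.eq_zero_of_ae_eval_eq_zero [IsProbabilityMeasure P] [NullSingletonClass P]
    {X : Ω → ℝ} (hX : Function.Injective X) {r : Polynomial ℝ}
    (h : ∀ᵐ ω ∂P, r.eval (X ω) = 0) : r = 0 := by
  by_contra hr
  have hfin : (X ⁻¹' {x | r.eval x = 0}).Finite := by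
    refine Set.Finite.preimage hX.injOn ?_
    refine (r.roots.toFinset.finite_toSet).subset fun x hx => ?_
    simpa [hr] using hx
  have h1 : P (X ⁻¹' {x | r.eval x = 0}) = 0 := hfin.measure_zero P
  have h2 : ∀ᵐ ω ∂P, r.eval (X ω) ≠ 0 := by
    rw [ae_iff]
    simpa using h1
  have h3 : ∀ᵐ ω ∂P, False := by
    filter_upwards [h, h2] with ω h h' using h' h
  rw [eventually_false_iff_eq_bot, ae_eq_bot] at h3
  exact IsProbabilityMeasure.ne_zero P h3

/-- Polynomials in a bounded injective function embed linearly in `L_q`, so finitely many linear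
conditions leave a nonzero one. -/
theorem exists_ne_zero_forall_lpMulPairing_eq_zero [StandardBorelSpace Ω] [IsProbabilityMeasure P]
    [NullSingletonClass P] (s : Finset (Lp ℝ p P)) :
    ∃ v : Lp ℝ q P, v ≠ 0 ∧ ∀ f ∈ s, lpMulPairing P p q f v = 0 := by
  let X : Ω → ℝ := fun ω => Real.arctan (embeddingReal Ω ω)
  have hXinj : Function.Injective X :=
    Real.arctan_injective.comp (measurableEmbedding_embeddingReal Ω).injective
  have hXm : Measurable X :=
    Real.measurable_arctan.comp (measurableEmbedding_embeddingReal Ω).measurable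
  have hmem : ∀ r : Polynomial ℝ, MemLp (fun ω => r.eval (X ω)) q P := fun r => by
    obtain ⟨C, hC⟩ := (isCompact_Icc (a := -(Real.pi / 2))
      (b := Real.pi / 2)).exists_bound_of_continuousOn (f := fun x => r.eval x)
        r.continuous.continuousOn
    exact MemLp.of_bound (r.continuous.measurable.comp hXm).aestronglyMeasurable C
      (ae_of_all _ fun ω => hC _ ⟨(Real.neg_pi_div_two_lt_arctan _).le,
        (Real.arctan_lt_pi_div_two _).le⟩)
  let e : Polynomial ℝ →ₗ[ℝ] Lp ℝ q P :=
    { toFun := fun r => (hmem r).toLp _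
      map_add' := fun r r' => by
        rw [← MemLp.toLp_add]
        congr 1
        funext ω
        simp
      map_smul' := fun c r => by
        rw [RingHom.id_apply, ← MemLp.toLp_const_smul]
        congr 1
        funext ω
        simp }
  have he : ∀ r, e r = 0 → r = 0 := fun r hr => by
    refine Polynomial.eq_zero_of_ae_eval_eq_zero (P := P) hXinj ?_
    have h1 : (fun ω => r.eval (X ω)) =ᵐ[P] e r := ((hmem r).coeFn_toLp).symm
    filter_upwards [h1, Lp.coeFn_zero ℝ q P] with ω h1 h2
    rw [h1, hr, h2, Pi.zero_apply]
  let T : Polynomial ℝ →ₗ[ℝ] (s → ℝ) :=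
    LinearMap.pi fun f => (lpMulPairing P p q f).toLinearMap ∘ₗ e
  have hT : ¬ Function.Injective T := fun hinj =>
    Polynomial.not_finite (R := ℝ) (Module.Finite.of_injective T hinj)
  rw [← LinearMap.ker_eq_bot, LinearMap.ker_eq_bot'] at hT
  push Not at hT
  obtain ⟨r, hr, hr0⟩ := hT
  exact ⟨e r, fun h => hr0 (he r h), fun f hf => congrFun hr ⟨f, hf⟩⟩

/-- For each finite set of test functions, moving `ζ` along an annihilated direction reaches the
unit sphere without changing the tested values. The net is indexed by these finite sets. -/
theorem neg_lpMulPairing_mem_metricCompactification [StandardBorelSpace Ω] [IsProbabilityMeasure P]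
    [NullSingletonClass P] (hp : 1 < p) (hp' : p ≠ ∞) (hq' : q ≠ ∞) {ζ : Lp ℝ q P}
    (hζ : ‖ζ‖ ≤ 1) :
    (fun f => -lpMulPairing P p q f ζ) ∈ metricCompactification (0 : Lp ℝ p P) := by
  have key : ∀ s : Finset (Lp ℝ p P), ∃ ζ' : Lp ℝ q P, ‖ζ'‖ = 1 ∧
      ∀ f ∈ s, lpMulPairing P p q f ζ' = lpMulPairing P p q f ζ := by
    intro s
    obtain ⟨v, hv0, hv⟩ := exists_ne_zero_forall_lpMulPairing_eq_zero (q := q) s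
    have hvn : 0 < ‖v‖ := norm_pos_iff.2 hv0
    -- At `a = 2 / ‖v‖` the norm is at least `2 - ‖ζ‖ ≥ 1`.
    have hcont : ContinuousOn (fun a : ℝ => ‖ζ + a • v‖) (Set.Icc 0 (2 / ‖v‖)) := by fun_prop
    obtain ⟨a, -, ha⟩ := intermediate_value_Icc (by positivity) hcont (show (1 : ℝ) ∈ _ from by
      refine ⟨by simpa using hζ, ?_⟩
      have h1 := norm_sub_le (ζ + (2 / ‖v‖) • v) ζ
      rw [add_sub_cancel_left, norm_smul, Real.norm_of_nonneg (by positivity),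
        div_mul_cancel₀ _ hvn.ne'] at h1
      linarith)
    exact ⟨ζ + a • v, ha, fun f hf => by simp [hv f hf]⟩
  choose Z hZ1 hZ using key
  refine isClosed_closure.mem_of_tendsto (b := atTop)
    (f := fun (s : Finset (Lp ℝ p P)) f => -lpMulPairing P p q f (Z s))
    (tendsto_pi_nhds.2 fun f => ?_) (Eventually.of_forall fun s =>
      neg_lpMulPairing_mem_metricCompactification_of_norm_eq_one hp hp' hq' (hZ1 s))
  refine tendsto_const_nhds.congr' ?_
  filter_upwards [eventually_ge_atTop {f}] with s hs
  rw [hZ s f (hs (Finset.mem_singleton_self f))]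

end Converse

/-! ### Mutual exclusion of the two forms, and the theorem. -/

section Exclusive

variable {Ω : Type*} [MeasurableSpace Ω] {P : Measure Ω} [IsProbabilityMeasure P]
  {p : ℝ≥0∞}

theorem rpow_le_two_rpow_mul_add {s τ r : ℝ} (hs : 0 < s) (hτ : 0 ≤ τ) :
    τ ^ s ≤ 2 ^ s * (|τ - r| ^ s + |r| ^ s) := by
  have h0 : 0 ≤ |τ - r| ^ s := by positivity
  have h1 : 0 ≤ |r| ^ s := by positivity
  have h2 : τ ≤ |τ - r| + |r| := by
    have := abs_add_le (τ - r) r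
    rw [sub_add_cancel] at this
    exact (le_abs_self τ).trans this
  rcases le_total |τ - r| |r| with h | h
  · calc τ ^ s ≤ (2 * |r|) ^ s := by gcongr; linarith
      _ = 2 ^ s * |r| ^ s := Real.mul_rpow (by norm_num) (by positivity)
      _ ≤ _ := by gcongr; linarith
  · calc τ ^ s ≤ (2 * |τ - r|) ^ s := by gcongr; linarith
      _ = 2 ^ s * |τ - r| ^ s := Real.mul_rpow (by norm_num) (by positivity)
      _ ≤ _ := by gcongr; linarith

theorem ofReal_rpow_le_randomMoment_const {ξ : Kernel Ω ℝ} [IsMarkovKernel ξ] (hp : 0 < p.toReal)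
    {τ : ℝ} (hτ : 0 ≤ τ) : ENNReal.ofReal (τ ^ p.toReal) ≤ ENNReal.ofReal (2 ^ p.toReal) *
      (randomMoment P p ξ (fun _ => τ) + randomMoment P p ξ (fun _ => 0)) := by
  simp only [randomMoment, zero_sub, abs_neg]
  have hm : Measurable fun r : ℝ => ENNReal.ofReal (|r| ^ p.toReal) := by fun_prop
  rw [← lintegral_add_right _ hm.lintegral_kernel, ← lintegral_const_mul' _ _ ENNReal.ofReal_ne_top]
  have h1 : ∀ ω, ENNReal.ofReal (τ ^ p.toReal) ≤ ENNReal.ofReal (2 ^ p.toReal) *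
      (∫⁻ r, ENNReal.ofReal (|τ - r| ^ p.toReal) ∂(ξ ω) +
        ∫⁻ r, ENNReal.ofReal (|r| ^ p.toReal) ∂(ξ ω)) := fun ω => by
    rw [← lintegral_add_right _ hm, ← lintegral_const_mul' _ _ ENNReal.ofReal_ne_top]
    calc ENNReal.ofReal (τ ^ p.toReal) = ∫⁻ _, ENNReal.ofReal (τ ^ p.toReal) ∂(ξ ω) := by simp
      _ ≤ _ := lintegral_mono fun r => by
        rw [← ENNReal.ofReal_add (by positivity) (by positivity),
          ← ENNReal.ofReal_mul (by positivity)]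
        exact ENNReal.ofReal_le_ofReal (rpow_le_two_rpow_mul_add hp hτ)
  calc ENNReal.ofReal (τ ^ p.toReal) = ∫⁻ _, ENNReal.ofReal (τ ^ p.toReal) ∂P := by simp
    _ ≤ _ := lintegral_mono h1

variable {q : ℝ≥0∞} [Fact (1 ≤ p)] [Fact (1 ≤ q)] [p.HolderConjugate q]

/-- The first form is at least `-c`, and a linear functional bounded below is zero. Then all random
moments would agree, yet those of large constants `τ` are unbounded. -/
theorem not_hasRandomMeasureForm_neg_lpMulPairing (hp' : p ≠ ∞) (ζ : Lp ℝ q P) :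
    ¬ HasRandomMeasureForm P p (fun f => -lpMulPairing P p q f ζ) := by
  rintro ⟨ξ, c, hξ, hc0, hM, hform⟩
  have hp0 : p ≠ 0 := (zero_lt_one.trans_le (Fact.out : 1 ≤ p)).ne'
  have hs : 0 < p.toReal := ENNReal.toReal_pos hp0 hp'
  set M := (randomMoment P p ξ (fun _ => 0)).toReal with hMdef
  have hMfin : randomMoment P p ξ (fun _ => 0) ≠ ∞ := ne_top_of_le_ne_top ENNReal.ofReal_ne_top hM
  have hMc : M ≤ c ^ p.toReal := ENNReal.toReal_le_of_le_ofReal (by positivity) hM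
  have hbase : ∀ f : Lp ℝ p P, 0 ≤ (randomMoment P p ξ f).toReal - M + c ^ p.toReal := fun f => by
    have : 0 ≤ (randomMoment P p ξ f).toReal := ENNReal.toReal_nonneg
    linarith
  have hlow : ∀ f : Lp ℝ p P, lpMulPairing P p q f ζ ≤ c := fun f => by
    have h1 := (hform f).2
    have h2 := Real.rpow_nonneg (hbase f) (1 / p.toReal)
    linarith
  have hzero : ∀ f : Lp ℝ p P, lpMulPairing P p q f ζ = 0 := fun f => by
    by_contra hne
    have h1 := hlow (((c + 1) / lpMulPairing P p q f ζ) • f)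
    rw [map_smul, smul_apply, smul_eq_mul, div_mul_cancel₀ _ hne] at h1
    linarith
  have hconst : ∀ f : Lp ℝ p P, (randomMoment P p ξ f).toReal = M := fun f => by
    have h1 := (hform f).2
    beta_reduce at h1
    rw [hzero, neg_zero] at h1
    have h2 : ((randomMoment P p ξ f).toReal - M + c ^ p.toReal) ^ (p.toReal)⁻¹ = c := by
      rw [one_div] at h1
      linarith
    rw [Real.rpow_inv_eq (hbase f) hc0 hs.ne'] at h2
    linarith
  obtain ⟨τ, hτ, hτ0⟩ := (((tendsto_rpow_atTop hs).eventually
    (eventually_gt_atTop (2 ^ p.toReal * (M + M)))).and (eventually_ge_atTop (0 : ℝ))).exists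
  have hτL : MemLp (fun _ : Ω => τ) p P := memLp_const τ
  have hcongr : randomMoment P p ξ (hτL.toLp _) = randomMoment P p ξ (fun _ => τ) := by
    refine lintegral_congr_ae ?_
    filter_upwards [hτL.coeFn_toLp] with ω hω
    rw [hω]
  have hfin : randomMoment P p ξ (fun _ => τ) ≠ ∞ := hcongr ▸ (hform (hτL.toLp _)).1
  have h1 := ofReal_rpow_le_randomMoment_const (P := P) (ξ := ξ) hs hτ0
  have h2 := ENNReal.toReal_mono (ENNReal.mul_ne_top ENNReal.ofReal_ne_top
    (ENNReal.add_ne_top.2 ⟨hfin, hMfin⟩)) h1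
  rw [ENNReal.toReal_mul, ENNReal.toReal_add hfin hMfin, ← hcongr, hconst, ← hMdef,
    ENNReal.toReal_ofReal (by positivity), ENNReal.toReal_ofReal (by positivity)] at h2
  linarith

end Exclusive

/-- Along this filter on `X`, the identity is a net of points whose internal functionals tend to
`h`. -/
theorem neBot_comap_of_mem_metricCompactification {X : Type*} [MetricSpace X] {x₀ : X} {h : X → ℝ}
    (hh : h ∈ metricCompactification x₀) :
    (comap (fun y => internalMetricFunctional x₀ y) (𝓝 h)).NeBot := by
  rw [comap_neBot_iff]
  intro t ht
  obtain ⟨_, hx, y, rfl⟩ := mem_closure_iff_nhds.1 hh t ht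
  exact ⟨y, hx⟩

theorem ENNReal.holderConjugate_div_sub_one {p : ℝ≥0∞} (hp : 1 < p) (hp' : p ≠ ∞) :
    p.HolderConjugate (p / (p - 1)) := by
  apply ENNReal.HolderConjugate.of_toReal
  rw [ENNReal.toReal_div, ENNReal.toReal_sub_of_le hp.le hp', ENNReal.toReal_one]
  refine Real.HolderConjugate.conjExponent ?_
  rw [← ENNReal.toReal_one]
  gcongr

theorem theorem2 {Ω : Type*} [MeasurableSpace Ω] [StandardBorelSpace Ω]
    (P : Measure Ω) [IsProbabilityMeasure P] [NullSingletonClass P]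
    (p : ℝ≥0∞) [Fact (1 ≤ p)] (hp : 1 < p) (hp' : p ≠ ∞) :
    -- every metric functional on `L_p` has exactly one of the two forms
    (∀ h ∈ metricCompactification (0 : Lp ℝ p P),
      Xor (HasRandomMeasureForm P p h) (HasLinearForm P p h)) ∧
    -- (eventually) bounded nets yield the first form, unbounded nets the second
    (∀ (ι : Type*) (l : Filter ι) [l.NeBot] (g : ι → Lp ℝ p P) (h : Lp ℝ p P → ℝ),
      (∀ f, Tendsto (fun i => internalMetricFunctional 0 (g i) f) l (𝓝 (h f))) →
      (l.IsBoundedUnder (· ≤ ·) (fun i => ‖g i‖) → HasRandomMeasureForm P p h) ∧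
      (¬ l.IsBoundedUnder (· ≤ ·) (fun i => ‖g i‖) → HasLinearForm P p h)) ∧
    -- every element of the closed unit ball of `L_{p / (p - 1)}` occurs in the second form
    (∀ ζ : Lp ℝ (p / (p - 1)) P, ‖ζ‖ ≤ 1 →
      negPairing P p ζ ∈ metricCompactification (0 : Lp ℝ p P)) := by
  have hpq := ENNReal.holderConjugate_div_sub_one hp hp'
  have hq : Fact (1 ≤ p / (p - 1)) := ⟨ENNReal.HolderConjugate.one_le _ p⟩
  have hq' : p / (p - 1) ≠ ∞ := ENNReal.div_ne_top hp' (tsub_pos_of_lt hp).ne'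
  have hneg : ∀ ζ : Lp ℝ (p / (p - 1)) P,
      negPairing P p ζ = fun f => -lpMulPairing P p (p / (p - 1)) f ζ := fun ζ => by
    funext f
    rw [negPairing, lpMulPairing_apply]
  have hexcl : ∀ h, HasRandomMeasureForm P p h → ¬ HasLinearForm P p h := by
    rintro _ h1 ⟨ζ, -, rfl⟩
    rw [hneg] at h1
    exact not_hasRandomMeasureForm_neg_lpMulPairing hp' ζ h1
  refine ⟨fun h hh => ?_, fun ι l _ g h hl => ?_, fun ζ hζ => ?_⟩
  · have := neBot_comap_of_mem_metricCompactification hh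
    have hl := tendsto_pi_nhds.1 (tendsto_comap (f := fun y : Lp ℝ p P =>
      internalMetricFunctional 0 y) (x := 𝓝 h))
    by_cases hb : (comap (fun y : Lp ℝ p P => internalMetricFunctional 0 y) (𝓝 h)).IsBoundedUnder
        (· ≤ ·) fun y => ‖y‖
    · have h1 := hasRandomMeasureForm_of_isBoundedUnder hp' hl hb
      exact Or.inl ⟨h1, hexcl h h1⟩
    · obtain ⟨ζ, hζ, rfl⟩ := exists_eq_neg_lpMulPairing_of_not_isBoundedUnder
        (q := p / (p - 1)) hp hp' hq' hl hb
      have h2 : HasLinearForm P p _ := ⟨ζ, hζ, (hneg ζ).symm⟩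
      exact Or.inr ⟨h2, fun h1 => hexcl _ h1 h2⟩
  · exact ⟨hasRandomMeasureForm_of_isBoundedUnder hp' hl, fun hb => by
      obtain ⟨ζ, hζ, rfl⟩ := exists_eq_neg_lpMulPairing_of_not_isBoundedUnder
        (q := p / (p - 1)) hp hp' hq' hl hb
      exact ⟨ζ, hζ, (hneg ζ).symm⟩⟩
  · rw [hneg]
    exact neg_lpMulPairing_mem_metricCompactification hp hp' hq' hζ
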